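/- Let $(p_k)_{k\ge 1}$ be a probability distribution ($p_k\ge 0$, $\sum_k p_k=1$) with $p_k>0$ for infinitely many $k$, and put $\rho(x):=\#\{k: p_k\ge 1/x\}$ for $x>0$. For $j\ge 1$ and a word $\mathbf r=r_1\cdots r_j\in\mathbb N^j$ put $p_{\mathbf r}:=p_{r_1}\cdots p_{r_j}$, and let $\rho_j(x):=\#\{\mathbf r\in\mathbb N^j: p_{\mathbf r}\ge 1/x\}$ for $x>0$. A real function $g$ is slowly varying at $\infty$ if it is positive and measurable on some half-line $[X,\infty)$ and $\lim_{x\to\infty} g(\lambda x)/g(x)=1$ for all $\lambda>0$. A function $h:(0,\infty)\to\mathbb R$ belongs to de Haan's class $\Pi$ with the auxiliary function $g$ if $g$ is slowly varying at $\infty$ and $\lim_{t\to\infty}(h(\lambda t)-h(t))/g(t)=\log\lambda$ for all $\lambda>0$. Assume that, for some $\beta\ge 0$ and some $\ell$ slowly varying at $\infty$, $$\lim_{t\to\infty}\frac{\rho(\lambda t)-\rho(t)}{(\log t)^\beta\,\ell(\log t)}=\log\lambda\qquad\text{for all }\lambda>0,$$ and, if $\beta=0$, assume further that $\ell$ is eventually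 nondecreasing and unbounded. Then, for every integer $j\ge 2$ and every $\lambda>0$, $$\lim_{t\to\infty}\frac{\rho_j(\lambda t)-\rho_j(t)}{(\log t)^{j\beta+j-1}(\ell(\log t))^j}=\frac{(\Gamma(\beta+1))^j}{\Gamma(j(\beta+1))}\log\lambda$$ and $$\lim_{t\to\infty}\frac{\rho_j(t)}{(\log t)^{j(\beta+1)}(\ell(\log t))^j}=\frac{(\Gamma(\beta+1))^j}{\Gamma(1+j(\beta+1))}.$$ In particular, $\rho_j$ belongs to de Haan's class $\Pi$ with the auxiliary function $t\mapsto \frac{(\Gamma(\beta+1))^j}{\Gamma(j(\beta+1))}(\log t)^{j\beta+j-1}(\ell(\log t))^j$. -/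

import Mathlib

open Filter Topology

namespace NestedKarlin

/-- `ℓ` is slowly varying at infinity: it is positive and (Borel) measurable on some
half-line `[X, ∞)`, and `ℓ (c x) / ℓ x → 1` as `x → ∞`, for every `c > 0`.
The values of `ℓ` outside a neighbourhood of infinity play no role. -/
def IsSlowlyVarying (ℓ : ℝ → ℝ) : Prop :=
  (∃ X : ℝ, (∀ x, X ≤ x → 0 < ℓ x) ∧ Measurable ((Set.Ici X).domRestrict ℓ)) ∧
    ∀ c : ℝ, 0 < c → Tendsto (fun x => ℓ (c * x) / ℓ x) atTop (𝓝 1)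

/-- `h` belongs to de Haan's class `Π` with the auxiliary function `g`. -/
def InDeHaanClassPi (h g : ℝ → ℝ) : Prop :=
  IsSlowlyVarying g ∧
    ∀ c : ℝ, 0 < c → Tendsto (fun t => (h (c * t) - h t) / g t) atTop (𝓝 (Real.log c))

/-- `ℓ` is nondecreasing and unbounded on some half-line `[X, ∞)`. -/
def EventuallyMonotoneUnbounded (ℓ : ℝ → ℝ) : Prop :=
  ∃ X : ℝ, MonotoneOn ℓ (Set.Ici X) ∧ ¬ BddAbove (ℓ '' Set.Ici X)

/-- The counting function `ρ(x) = #{k : p_k ≥ 1/x}`. -/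
noncomputable def rho (p : ℕ → ℝ) (x : ℝ) : ℝ :=
  ({k : ℕ | 1 / x ≤ p k}.ncard : ℝ)

/-- The weight `p_r = p_{r_1} ⋯ p_{r_j}` of the individual `r = r_1 … r_j` of generation `j`. -/
def weight (p : ℕ → ℝ) {j : ℕ} (r : Fin j → ℕ) : ℝ :=
  ∏ i, p (r i)

/-- The ancestor has weight one. -/
theorem weight_zero (p : ℕ → ℝ) (r : Fin 0 → ℕ) : weight p r = 1 := by
  simp [weight]

/-- The branching rule `p_{ri} = p_r p_i`. -/
theorem weight_snoc (p : ℕ → ℝ) {j : ℕ} (r : Fin j → ℕ) (i : ℕ) :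
    weight p (Fin.snoc r i : Fin (j + 1) → ℕ) = weight p r * p i := by
  simp [weight, Fin.prod_univ_castSucc]

/-- The counting function `ρ_j(x) = #{r : |r| = j, p_r ≥ 1/x}` of generation `j`. -/
noncomputable def rhoGen (p : ℕ → ℝ) (j : ℕ) (x : ℝ) : ℝ :=
  ({r : Fin j → ℕ | 1 / x ≤ weight p r}.ncard : ℝ)

/-- The sets counted by `rhoGen` are finite, so that `ncard` is their number of elements. -/
theorem finite_weight_ge {p : ℕ → ℝ} (hp0 : ∀ k, 0 ≤ p k) (hp1 : HasSum p 1) (j : ℕ)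
    {x : ℝ} (hx : 0 < x) : {r : Fin j → ℕ | 1 / x ≤ weight p r}.Finite := by
  have hle : ∀ k, p k ≤ 1 := fun k => le_hasSum hp1 k (fun i _ => hp0 i)
  have hfin : {k : ℕ | 1 / x ≤ p k}.Finite := by
    have h := hp1.summable.tendsto_cofinite_zero.eventually (gt_mem_nhds (one_div_pos.mpr hx))
    have h2 : {k : ℕ | ¬ p k < 1 / x}.Finite := h
    simpa only [not_lt] using h2
  refine (Set.Finite.pi' (fun _ : Fin j => hfin)).subset ?_
  intro r hr i
  have hr' : 1 / x ≤ ∏ i, p (r i) := hr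
  refine le_trans hr' ?_
  rw [← Finset.mul_prod_erase Finset.univ (fun i => p (r i)) (Finset.mem_univ i)]
  exact mul_le_of_le_one_right (hp0 _)
    (Finset.prod_le_one (fun k _ => hp0 _) (fun k _ => hle _))

/-- In the first generation `ρ_1 = ρ`. -/
theorem rhoGen_one (p : ℕ → ℝ) : rhoGen p 1 = rho p := by
  funext x
  have h : {r : Fin 1 → ℕ | 1 / x ≤ weight p r}
      = (Equiv.funUnique (Fin 1) ℕ) ⁻¹' {k : ℕ | 1 / x ≤ p k} := by
    ext r
    simp [weight]
  unfold rhoGen rho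
  rw [h, Set.ncard_preimage_of_injective_subset_range (Equiv.injective _) (by simp)]

end NestedKarlin

/-! With `t = exp y`, products of weights become sums of the exponents `-log p_k`, and `ρ_j (exp y)`
becomes the number `N_j y` of words whose exponent is at most `y`. The hypothesis reads `N_1 (y + h)
- N_1 y ~ h * g y` with `g y = y ^ β * ℓ y`, and `N_{j+1}` is the convolution of `N_1` with `N_j`.
So it suffices to understand the increments of a convolution (`HasIncrements.levelCount_add`) and to
induct on the generation.

Cut both axes into cells of length `δ`. The number of pairs whose cell indices add up to `l` is
exactly a discrete convolution of cell counts. After normalisation it is an integral over `[0, 1]`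
of a step function, which converges by dominated convergence to a multiple of `∫ x ^ α * (1 - x) ^
β`, a quotient of Gamma values (`tendsto_convolution`). A pair on diagonal `l` has its sum in `((l -
2) δ, l δ]`, so an increment of length `h = n δ` lies between sums over `n - 2` and `n + 2`
diagonals; then `n → ∞`. In the induction the Gamma values telescope.

The pointwise limit comes from invariance under bounded shifts together with regular variation, the
dominating constant from almost monotonicity; `IsRegGrowth` collects these. For `g` they rest on the
uniform convergence theorem. The asymptotics of `N_j` itself follow by summing its unit increments
(`tendsto_total`). -/

namespace NestedKarlin

open Set MeasureTheory

/-! ### Uniform convergence theorem -/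

/-- The uniform convergence theorem for measurable slowly varying functions, in additive form. -/
theorem uniform_of_tendsto_shift {h : ℝ → ℝ} (hm : Measurable h)
    (hh : ∀ u, Tendsto (fun x => h (x + u) - h x) atTop (𝓝 0)) {ε : ℝ} (hε : 0 < ε) :
    ∃ X, ∀ x, X ≤ x → ∀ u ∈ Icc (0 : ℝ) 1, |h (x + u) - h x| < ε := by
  -- Truncation at 1 gives a dominating function, so the mean of `F x` over `[0, 2]` tends to 0
  -- although the convergence is only pointwise.
  set F : ℝ → ℝ → ℝ := fun x v => min 1 |h (x + v) - h x| with hF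
  have hF0 : ∀ x v, 0 ≤ F x v := fun x v => le_min zero_le_one (abs_nonneg _)
  have hFm : ∀ x, Measurable (F x) := fun x =>
    measurable_const.min
      ((hm.comp (measurable_const.add measurable_id)).sub measurable_const).abs
  have hFn : ∀ x v, ‖F x v‖ ≤ 1 := fun x v => by
    rw [Real.norm_of_nonneg (hF0 x v)]; exact min_le_left _ _
  have hFi : ∀ x a b, IntervalIntegrable (F x) volume a b := fun x a b =>
    (intervalIntegrable_const (c := (1 : ℝ))).mono_fun (hFm x).aestronglyMeasurable
      (Eventually.of_forall fun v => by simpa using hFn x v)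
  have hφ : Tendsto (fun x => ∫ v in (0 : ℝ)..2, F x v) atTop (𝓝 0) := by
    have := intervalIntegral.tendsto_integral_filter_of_dominated_convergence
      (μ := volume) (a := 0) (b := 2) (l := (atTop : Filter ℝ)) (F := F) (f := fun _ => 0)
      (fun _ => (1 : ℝ)) (Eventually.of_forall fun x => (hFm x).aestronglyMeasurable)
      (Eventually.of_forall fun x => Eventually.of_forall fun v _ => hFn x v)
      intervalIntegrable_const
      (Eventually.of_forall fun v _ => by
        simpa [hF] using (tendsto_const_nhds (x := (1 : ℝ))).min (hh v).abs)
    simpa using this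
  have hδ : 0 < min ε 1 / 2 := by positivity
  obtain ⟨X, hX⟩ := eventually_atTop.1 (hφ.eventually (gt_mem_nhds hδ))
  refine ⟨X, fun x hx u hu => ?_⟩
  by_contra! hcon
  have h1 := hX x hx
  have h2 := hX (x + u) (by linarith [hu.1])
  have hsub : ∀ y a b, 0 ≤ a → a ≤ b → b ≤ 2 →
      ∫ v in a..b, F y v ≤ ∫ v in (0 : ℝ)..2, F y v := fun y a b ha hab hb =>
    intervalIntegral.integral_mono_interval ha hab hb
      (Eventually.of_forall fun v => hF0 y v) (hFi y 0 2)
  have h3 := hsub x 1 2 (by norm_num) (by norm_num) le_rfl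
  have h4 := hsub (x + u) (1 - u) (2 - u) (by linarith [hu.2]) (by linarith) (by linarith [hu.1])
  have h5 : ∫ v in (1 - u)..(2 - u), F (x + u) v = ∫ v in (1 : ℝ)..2, F (x + u) (v - u) := by
    rw [intervalIntegral.integral_comp_sub_right (fun v => F (x + u) v)]
  have hi : IntervalIntegrable (fun v => F (x + u) (v - u)) volume 1 2 := by
    simpa using (hFi (x + u) (1 - u) (2 - u)).comp_sub_right u
  -- If the increment from `x` to `x + u` is at least `ε`, then for every `v` one of the increments
  -- from `x` or from `x + u` to `x + v` is large. Averaging over `v` in `[1, 2]` contradicts the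
  -- smallness of both means, as `v - u` stays in `[0, 2]`.
  have h6 : min ε 1 ≤ ∫ v in (1 : ℝ)..2, (F x v + F (x + u) (v - u)) := by
    have : ∫ _ in (1 : ℝ)..2, min ε 1 ≤ ∫ v in (1 : ℝ)..2, (F x v + F (x + u) (v - u)) := by
      refine intervalIntegral.integral_mono_on (by norm_num) intervalIntegrable_const
        ((hFi x 1 2).add hi) fun v _ => ?_
      have e : x + u + (v - u) = x + v := by ring
      simp only [hF, e]
      have ht : |h (x + u) - h x| ≤ |h (x + v) - h x| + |h (x + v) - h (x + u)| := by
        linarith [abs_sub_le (h (x + u)) (h (x + v)) (h x),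
          abs_sub_comm (h (x + v)) (h (x + u))]
      rcases le_total 1 |h (x + v) - h x| with ha | ha
      · rw [min_eq_left ha]
        linarith [min_le_right ε 1, le_min zero_le_one (abs_nonneg (h (x + v) - h (x + u)))]
      rcases le_total 1 |h (x + v) - h (x + u)| with hb | hb
      · rw [min_eq_left hb]
        linarith [min_le_right ε 1, le_min zero_le_one (abs_nonneg (h (x + v) - h x))]
      rw [min_eq_right ha, min_eq_right hb]
      linarith [min_le_left ε 1]
    have e : ∫ _ in (1 : ℝ)..2, min ε 1 = min ε 1 := by
      rw [intervalIntegral.integral_const]; norm_num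
    rwa [e] at this
  rw [intervalIntegral.integral_add (hFi x 1 2) hi, ← h5] at h6
  linarith

/-! ### Functions of regular growth -/

/-- Functions of regular growth of index `α`: eventually positive, asymptotically invariant under
bounded shifts, regularly varying of index `α`, and almost increasing. -/
structure IsRegGrowth (g : ℝ → ℝ) (α : ℝ) : Prop where
  pos : ∀ᶠ y in atTop, 0 < g y
  shift : ∀ C : ℝ, Tendsto (fun q : ℝ × ℝ => g (q.1 + q.2) / g q.1)
    (atTop ×ˢ 𝓟 (Icc (-C) C)) (𝓝 1)
  scale : ∀ x : ℝ, 0 < x → Tendsto (fun y => g (x * y) / g y) atTop (𝓝 (x ^ α))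
  dom : ∃ K Y : ℝ, 0 < K ∧ ∀ s t, Y ≤ s → s ≤ t → g s ≤ K * g t

theorem tendsto_add_prod_atTop (C : ℝ) :
    Tendsto (fun q : ℝ × ℝ => q.1 + q.2) (atTop ×ˢ 𝓟 (Icc (-C) C)) atTop := by
  have h1 : Tendsto (fun q : ℝ × ℝ => q.1 + -C) (atTop ×ˢ 𝓟 (Icc (-C) C)) atTop :=
    tendsto_atTop_add_const_right _ _ tendsto_fst
  refine tendsto_atTop_mono' _ ?_ h1
  have h2 : ∀ᶠ q : ℝ × ℝ in atTop ×ˢ 𝓟 (Icc (-C) C), q.2 ∈ Icc (-C) C :=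
    tendsto_snd.eventually (mem_principal_self _)
  filter_upwards [h2] with q hq
  linarith [hq.1]

theorem tendsto_add_div_prod (C : ℝ) :
    Tendsto (fun q : ℝ × ℝ => (q.1 + q.2) / q.1) (atTop ×ˢ 𝓟 (Icc (-C) C)) (𝓝 1) := by
  have h2 : ∀ᶠ q : ℝ × ℝ in atTop ×ˢ 𝓟 (Icc (-C) C), q.2 ∈ Icc (-C) C :=
    tendsto_snd.eventually (mem_principal_self _)
  have h3 : ∀ᶠ q : ℝ × ℝ in atTop ×ˢ 𝓟 (Icc (-C) C), 0 < q.1 :=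
    tendsto_fst.eventually (eventually_gt_atTop 0)
  have h4 : Tendsto (fun q : ℝ × ℝ => C / q.1) (atTop ×ˢ 𝓟 (Icc (-C) C)) (𝓝 0) :=
    tendsto_fst.const_div_atTop C
  have h5 : Tendsto (fun q : ℝ × ℝ => q.2 / q.1) (atTop ×ˢ 𝓟 (Icc (-C) C)) (𝓝 0) := by
    refine squeeze_zero_norm' ?_ h4
    filter_upwards [h2, h3] with q hq hq'
    rw [Real.norm_eq_abs, abs_div, abs_of_pos hq']
    gcongr
    exact abs_le.2 hq
  have h6 := h5.const_add 1
  rw [add_zero] at h6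
  refine h6.congr' ?_
  filter_upwards [h3] with q hq
  field_simp

namespace IsRegGrowth

theorem const_one : IsRegGrowth (fun _ => 1) 0 where
  pos := by simp
  shift C := by simpa using tendsto_const_nhds
  scale x _ := by simp
  dom := ⟨1, 0, one_pos, by simp⟩

theorem id : IsRegGrowth (fun y => y) 1 where
  pos := eventually_gt_atTop 0
  shift := tendsto_add_div_prod
  scale x _ := by
    rw [Real.rpow_one]
    refine tendsto_const_nhds.congr' ?_
    filter_upwards [eventually_gt_atTop 0] with y hy
    field_simp
  dom := ⟨1, 0, one_pos, by simp⟩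

theorem mul {g k : ℝ → ℝ} {α β : ℝ} (hg : IsRegGrowth g α) (hk : IsRegGrowth k β) :
    IsRegGrowth (fun y => g y * k y) (α + β) where
  pos := by filter_upwards [hg.pos, hk.pos] with y h1 h2 using mul_pos h1 h2
  shift C := by
    simpa [mul_div_mul_comm] using (hg.shift C).mul (hk.shift C)
  scale x hx := by
    rw [Real.rpow_add hx]
    simpa [mul_div_mul_comm] using (hg.scale x hx).mul (hk.scale x hx)
  dom := by
    obtain ⟨K, Y, hK, h⟩ := hg.dom
    obtain ⟨K', Y', hK', h'⟩ := hk.dom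
    obtain ⟨Z, hZ⟩ := eventually_atTop.1 (hg.pos.and hk.pos)
    refine ⟨K * K', max Z (max Y Y'), mul_pos hK hK', fun s t hs hst => ?_⟩
    have hZs : Z ≤ s := (le_max_left _ _).trans hs
    have hYs : Y ≤ s := ((le_max_left _ _).trans (le_max_right _ _)).trans hs
    have hYs' : Y' ≤ s := ((le_max_right _ _).trans (le_max_right _ _)).trans hs
    have h1 := (hZ s hZs).2
    have h2 := (hZ t (hZs.trans hst)).1
    calc g s * k s ≤ (K * g t) * (K' * k t) :=
          mul_le_mul (h s t hYs hst) (h' s t hYs' hst) h1.le (by positivity)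
      _ = K * K' * (g t * k t) := by ring

/-- Since `shift` is uniform in the displacement, the displacement may vary along the filter as long
as it stays bounded; this is what absorbs all rounding errors below. -/
theorem tendsto_shift {X : Type*} {l : Filter X} {g : ℝ → ℝ} {α : ℝ} (hg : IsRegGrowth g α)
    {f k : X → ℝ} (hk : Tendsto k l atTop) (C : ℝ) (hC : ∀ᶠ x in l, |f x - k x| ≤ C) :
    Tendsto (fun x => g (f x) / g (k x)) l (𝓝 1) := by
  have h : Tendsto (fun x => (k x, f x - k x)) l (atTop ×ˢ 𝓟 (Icc (-C) C)) :=
    hk.prodMk (tendsto_principal.2 (hC.mono fun x hx => abs_le.1 hx))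
  simpa [Function.comp_def] using (hg.shift C).comp h

end IsRegGrowth

/-! ### Slowly varying functions and regular growth -/

theorem IsSlowlyVarying.log_uniform {ℓ : ℝ → ℝ} (hℓ : IsSlowlyVarying ℓ) {ε : ℝ} (hε : 0 < ε) :
    ∃ X, ∀ x, X ≤ x → ∀ u ∈ Icc (0 : ℝ) 1,
      |Real.log (ℓ (Real.exp (x + u))) - Real.log (ℓ (Real.exp x))| < ε := by
  obtain ⟨⟨X₀, hpos, hmeas⟩, hlim⟩ := hℓ
  -- Freezing `ℓ` below `X₀` gives a function measurable on all of `ℝ` with the same germ at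
  -- infinity.
  set k : ℝ → ℝ := fun y => ℓ (max y X₀) with hk
  have hkm : Measurable k := by
    have : k = (Ici X₀).domRestrict ℓ ∘ fun y => ⟨max y X₀, le_max_right y X₀⟩ := rfl
    rw [this]
    exact hmeas.comp ((measurable_id.max measurable_const).subtype_mk)
  have hev : ∀ u : ℝ, ∀ᶠ x in atTop, k (Real.exp (x + u)) = ℓ (Real.exp (x + u)) := fun u => by
    have : Tendsto (fun x => Real.exp (x + u)) atTop atTop :=
      Real.tendsto_exp_atTop.comp (tendsto_atTop_add_const_right _ _ tendsto_id)
    filter_upwards [this.eventually_ge_atTop X₀] with x hx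
    simp [hk, max_eq_left hx]
  have hp : ∀ u : ℝ, ∀ᶠ x in atTop, 0 < ℓ (Real.exp (x + u)) := fun u => by
    have : Tendsto (fun x => Real.exp (x + u)) atTop atTop :=
      Real.tendsto_exp_atTop.comp (tendsto_atTop_add_const_right _ _ tendsto_id)
    filter_upwards [this.eventually_ge_atTop X₀] with x hx using hpos _ hx
  obtain ⟨X, hX⟩ := uniform_of_tendsto_shift (h := fun x => Real.log (k (Real.exp x)))
    (Real.measurable_log.comp (hkm.comp Real.measurable_exp)) (fun u => by
      have h1 := (hlim (Real.exp u) (Real.exp_pos u)).comp Real.tendsto_exp_atTop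
      have h2 := h1.log one_ne_zero
      rw [Real.log_one] at h2
      refine h2.congr' ?_
      filter_upwards [hev u, hev 0, hp u, hp 0] with x a b c d
      simp only [add_zero] at b d
      have e : Real.exp u * Real.exp x = Real.exp (x + u) := by
        rw [← Real.exp_add, add_comm]
      simp only [Function.comp, e, a, b]
      rw [Real.log_div c.ne' d.ne']) hε
  obtain ⟨Y, hY⟩ := eventually_atTop.1 (Real.tendsto_exp_atTop.eventually_ge_atTop X₀)
  refine ⟨max X Y, fun x hx u hu => ?_⟩
  have := hX x ((le_max_left _ _).trans hx) u hu
  have e1 : k (Real.exp (x + u)) = ℓ (Real.exp (x + u)) := by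
    simp [hk, max_eq_left (hY (x + u) (by linarith [le_max_right X Y, hu.1]))]
  have e2 : k (Real.exp x) = ℓ (Real.exp x) := by
    simp [hk, max_eq_left (hY x (by linarith [le_max_right X Y]))]
  simpa [e1, e2] using this

theorem IsSlowlyVarying.eventually_pos {ℓ : ℝ → ℝ} (hℓ : IsSlowlyVarying ℓ) :
    ∀ᶠ y in atTop, 0 < ℓ y := by
  obtain ⟨X, hX⟩ := hℓ.1
  exact eventually_atTop.2 ⟨X, hX.1⟩

theorem IsSlowlyVarying.log_uniform_mul {ℓ : ℝ → ℝ} (hℓ : IsSlowlyVarying ℓ) {ε : ℝ}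
    (hε : 0 < ε) :
    ∃ Y, 0 < Y ∧ ∀ y z, Y ≤ y → y ≤ z → z ≤ Real.exp 1 * y →
      |Real.log (ℓ z) - Real.log (ℓ y)| < ε := by
  obtain ⟨X, hX⟩ := hℓ.log_uniform hε
  refine ⟨Real.exp X, Real.exp_pos X, fun y z hy hyz hz => ?_⟩
  have hy0 : 0 < y := (Real.exp_pos X).trans_le hy
  have hz0 : 0 < z := hy0.trans_le hyz
  have hl : Real.log z ≤ 1 + Real.log y := by
    have := Real.log_le_log hz0 hz
    rwa [Real.log_mul (Real.exp_pos 1).ne' hy0.ne', Real.log_exp] at this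
  have := hX (Real.log y) ((Real.le_log_iff_exp_le hy0).2 hy) (Real.log z - Real.log y)
    ⟨by linarith [Real.log_le_log hy0 hyz], by linarith⟩
  simpa [Real.exp_log hy0, Real.exp_log hz0] using this

/-- A bounded shift eventually changes the argument by a factor between `exp (-1)` and `exp 1`,
where `log_uniform_mul` applies to the smaller of the two arguments. -/
theorem IsSlowlyVarying.tendsto_shift {ℓ : ℝ → ℝ} (hℓ : IsSlowlyVarying ℓ) (C : ℝ) :
    Tendsto (fun q : ℝ × ℝ => ℓ (q.1 + q.2) / ℓ q.1) (atTop ×ˢ 𝓟 (Icc (-C) C)) (𝓝 1) := by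
  have hlog : Tendsto (fun q : ℝ × ℝ => Real.log (ℓ (q.1 + q.2)) - Real.log (ℓ q.1))
      (atTop ×ˢ 𝓟 (Icc (-C) C)) (𝓝 0) := by
    rw [Metric.tendsto_nhds]
    intro ε hε
    obtain ⟨Y, hY0, hY⟩ := hℓ.log_uniform_mul hε
    have he : (1 : ℝ) < Real.exp 1 := Real.one_lt_exp_iff.2 one_pos
    have hr := tendsto_add_div_prod C
    have hr' : Tendsto (fun q : ℝ × ℝ => ((q.1 + q.2) / q.1)⁻¹) (atTop ×ˢ 𝓟 (Icc (-C) C)) (𝓝 1) := by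
      simpa using hr.inv₀ one_ne_zero
    filter_upwards [(tendsto_add_prod_atTop C).eventually_ge_atTop Y,
      tendsto_fst.eventually_ge_atTop Y, hr.eventually (gt_mem_nhds he),
      hr'.eventually (gt_mem_nhds he)] with q h1 h2 h3 h4
    have p1 : 0 < q.1 + q.2 := hY0.trans_le h1
    have p2 : 0 < q.1 := hY0.trans_le h2
    rw [inv_div, div_lt_iff₀ p1] at h4
    rw [div_lt_iff₀ p2] at h3
    rw [Real.dist_0_eq_abs]
    rcases le_total q.1 (q.1 + q.2) with h | h
    · exact hY _ _ h2 h h3.le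
    · rw [abs_sub_comm]; exact hY _ _ h1 h h4.le
  have := (Real.continuous_exp.tendsto 0).comp hlog
  rw [Real.exp_zero] at this
  refine this.congr' ?_
  filter_upwards [(tendsto_add_prod_atTop C).eventually hℓ.eventually_pos,
    tendsto_fst.eventually hℓ.eventually_pos] with q h1 h2
  simp only [Function.comp]
  rw [Real.exp_sub, Real.exp_log h1, Real.exp_log h2]

/-- A regularly varying function of positive index is almost increasing. -/
theorem IsSlowlyVarying.exists_rpow_mul_le {ℓ : ℝ → ℝ} (hℓ : IsSlowlyVarying ℓ) {β : ℝ}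
    (hβ : 0 < β) :
    ∃ K Y : ℝ, 0 < K ∧ ∀ s t, Y ≤ s → s ≤ t → s ^ β * ℓ s ≤ K * (t ^ β * ℓ t) := by
  -- With tolerance `β`, the drift `β * x` outweighs the variation of `log ℓ` over a unit step, so
  -- `H` does not decrease along unit steps. The last fractional step loses at most `β`, whence `K =
  -- exp β`.
  obtain ⟨X, hX⟩ := hℓ.log_uniform hβ
  obtain ⟨P, hP⟩ := eventually_atTop.1 hℓ.eventually_pos
  set H : ℝ → ℝ := fun x => β * x + Real.log (ℓ (Real.exp x)) with hH
  have hstep : ∀ n : ℕ, ∀ x, X ≤ x → H x ≤ H (x + n) := by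
    intro n
    induction n with
    | zero => intro x _; simp
    | succ n ih =>
      intro x hx
      refine (ih x hx).trans ?_
      have hn : X ≤ x + n := by have := Nat.cast_nonneg (α := ℝ) n; linarith
      have := abs_lt.1 (hX (x + n) hn 1 ⟨zero_le_one, le_rfl⟩)
      have e : x + ((n + 1 : ℕ) : ℝ) = x + n + 1 := by push_cast; ring
      rw [e]
      simp only [hH]
      linarith [this.1]
  have hmain : ∀ x z, X ≤ x → x ≤ z → H x ≤ β + H z := by
    intro x z hx hxz
    set n := ⌊z - x⌋₊ with hn
    have h1 : (n : ℝ) ≤ z - x := Nat.floor_le (by linarith)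
    have h2 : z - x < n + 1 := Nat.lt_floor_add_one _
    have hxn : X ≤ x + n := by have := Nat.cast_nonneg (α := ℝ) n; linarith
    have h3 := abs_lt.1 (hX (x + n) hxn (z - (x + n)) ⟨by linarith, by linarith⟩)
    have h4 := hstep n x hx
    rw [add_sub_cancel] at h3
    simp only [hH] at h4 ⊢
    nlinarith [h3.1, mul_nonneg hβ.le (by linarith : 0 ≤ z - (x + n))]
  refine ⟨Real.exp β, max P (Real.exp X), Real.exp_pos β, fun s t hs hst => ?_⟩
  have hs0 : 0 < s := (Real.exp_pos X).trans_le ((le_max_right _ _).trans hs)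
  have ht0 : 0 < t := hs0.trans_le hst
  have key : ∀ r, 0 < r → P ≤ r → r ^ β * ℓ r = Real.exp (H (Real.log r)) := by
    intro r hr hPr
    simp only [hH]
    rw [Real.exp_log hr, Real.exp_add, Real.exp_log (hP r hPr), Real.rpow_def_of_pos hr, mul_comm β]
  have hPs := (le_max_left _ _).trans hs
  rw [key s hs0 hPs, key t ht0 (hPs.trans hst), ← Real.exp_add]
  refine Real.exp_le_exp.2 (hmain _ _ ?_ (Real.log_le_log hs0 hst))
  exact (Real.le_log_iff_exp_le hs0).2 ((le_max_right _ _).trans hs)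

/-- Only `dom` is sensitive to `β = 0`: a slowly varying function need not be almost increasing, so
there monotonicity of `ℓ` is used. -/
theorem IsSlowlyVarying.isRegGrowth {ℓ : ℝ → ℝ} (hℓ : IsSlowlyVarying ℓ) {β : ℝ} (hβ : 0 ≤ β)
    (hβ_zero : β = 0 → EventuallyMonotoneUnbounded ℓ) :
    IsRegGrowth (fun y => y ^ β * ℓ y) β where
  pos := by
    filter_upwards [hℓ.eventually_pos, eventually_gt_atTop 0] with y h1 h2
    exact mul_pos (Real.rpow_pos_of_pos h2 _) h1
  shift C := by
    have h1 := ((tendsto_add_div_prod C).rpow_const (p := β) (Or.inl one_ne_zero)).mul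
      (hℓ.tendsto_shift C)
    rw [Real.one_rpow, one_mul] at h1
    refine h1.congr' ?_
    filter_upwards [(tendsto_add_prod_atTop C).eventually_ge_atTop 0,
      tendsto_fst.eventually_ge_atTop 0] with q h2 h3
    rw [Real.div_rpow h2 h3, mul_div_mul_comm]
  scale x hx := by
    have h1 := (hℓ.2 x hx).const_mul (x ^ β)
    rw [mul_one] at h1
    refine h1.congr' ?_
    filter_upwards [eventually_gt_atTop 0] with y hy
    have := (Real.rpow_pos_of_pos hy β).ne'
    rw [Real.mul_rpow hx.le hy.le]
    field_simp
  dom := by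
    rcases hβ.eq_or_lt with h | h
    · obtain ⟨X, hX, -⟩ := hβ_zero h.symm
      refine ⟨1, X, one_pos, fun s t hs hst => ?_⟩
      simpa [← h] using hX hs (hs.trans hst) hst
    · exact hℓ.exists_rpow_mul_le h

/-! ### Beta integral and convolutions of sequences -/

theorem integral_rpow_mul_one_sub_rpow {α β : ℝ} (hα : 0 ≤ α) (hβ : 0 ≤ β) :
    ∫ x in (0 : ℝ)..1, x ^ α * (1 - x) ^ β =
      Real.Gamma (α + 1) * Real.Gamma (β + 1) / Real.Gamma (α + 1 + (β + 1)) := by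
  have h := ProbabilityTheory.beta_eq_betaIntegralReal (α + 1) (β + 1) (by linarith) (by linarith)
  rw [ProbabilityTheory.beta] at h
  rw [h, Complex.betaIntegral]
  have e : ∫ x in (0 : ℝ)..1, (x : ℂ) ^ (((α + 1 : ℝ) : ℂ) - 1) *
      (1 - (x : ℂ)) ^ (((β + 1 : ℝ) : ℂ) - 1) =
      ∫ x in (0 : ℝ)..1, ((x ^ α * (1 - x) ^ β : ℝ) : ℂ) := by
    refine intervalIntegral.integral_congr fun x hx => ?_
    rw [uIcc_of_le zero_le_one] at hx
    have e1 : ((α + 1 : ℝ) : ℂ) - 1 = (α : ℂ) := by push_cast; ring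
    have e2 : ((β + 1 : ℝ) : ℂ) - 1 = (β : ℂ) := by push_cast; ring
    simp only [e1, e2]
    rw [Complex.ofReal_mul, Complex.ofReal_cpow hx.1, Complex.ofReal_cpow (by linarith [hx.2])]
    push_cast
    rfl
  rw [e, intervalIntegral.integral_ofReal, Complex.ofReal_re]

theorem integral_floor_eq_sum (F : ℕ → ℝ) (n : ℕ) :
    ∫ x in (0 : ℝ)..1, F ⌊((n : ℝ) + 1) * x⌋₊ = (∑ i ∈ Finset.range (n + 1), F i) / (n + 1) := by
  have hn : ((n : ℝ) + 1) ≠ 0 := by positivity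
  have hc : ∀ k : ℕ, EqOn (fun _ : ℝ => F k) (fun x : ℝ => F ⌊x⌋₊)
      (uIoo (k : ℝ) ((k + 1 : ℕ) : ℝ)) := by
    intro k x hx
    rw [uIoo_of_le (by push_cast; linarith)] at hx
    have : ⌊x⌋₊ = k := by
      rw [Nat.floor_eq_iff ((Nat.cast_nonneg k).trans hx.1.le)]
      exact ⟨hx.1.le, by have := hx.2; push_cast at this; exact this⟩
    simp only [this]
  have h := intervalIntegral.sum_integral_adjacent_intervals (μ := volume)
    (f := fun x : ℝ => F ⌊x⌋₊) (a := fun k => (k : ℝ)) (n := n + 1)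
    (fun k _ => (intervalIntegrable_const (c := F k)).congr_uIoo (hc k))
  have h2 : ∀ k : ℕ, ∫ x in (k : ℝ)..((k + 1 : ℕ) : ℝ), F ⌊x⌋₊ = F k := fun k => by
    rw [← intervalIntegral.integral_congr_uIoo (hc k)]; simp
  simp only [h2] at h
  rw [intervalIntegral.integral_comp_mul_left (fun x => F ⌊x⌋₊) hn, h]
  push_cast
  rw [mul_zero, mul_one, smul_eq_mul, div_eq_inv_mul]

theorem tendsto_natCast_mul_atTop {δ : ℝ} (hδ : 0 < δ) :
    Tendsto (fun L : ℕ => (L : ℝ) * δ) atTop atTop :=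
  tendsto_natCast_atTop_atTop.atTop_mul_const hδ

namespace IsRegGrowth

variable {a : ℝ → ℝ} {α δ c : ℝ} {u : ℕ → ℝ}

/-- The quotient splits as `u i / a (i δ)`, times `a (i δ) / a (x L δ)`, times `a (x L δ) / a (L
δ)`, with limits `c`, `1` and `x ^ α`. -/
theorem tendsto_seq (ha : IsRegGrowth a α) (hδ : 0 < δ)
    (huc : Tendsto (fun i : ℕ => u i / a (i * δ)) atTop (𝓝 c)) {x C : ℝ} (hx : 0 < x)
    {i : ℕ → ℕ} (hi : ∀ L, |(i L : ℝ) - x * L| ≤ C) :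
    Tendsto (fun L : ℕ => u (i L) / a (L * δ)) atTop (𝓝 (c * x ^ α)) := by
  have hiT : Tendsto i atTop atTop := by
    refine (tendsto_natCast_atTop_iff (R := ℝ)).1 ?_
    refine tendsto_atTop_mono (f := fun L : ℕ => (L : ℝ) * x + -C) (fun L => ?_)
      (tendsto_atTop_add_const_right _ _ (tendsto_natCast_mul_atTop hx))
    linarith [(abs_le.1 (hi L)).1]
  have hT := tendsto_natCast_mul_atTop hδ
  have hxT : Tendsto (fun L : ℕ => x * ((L : ℝ) * δ)) atTop atTop := hT.const_mul_atTop hx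
  have hs := ha.tendsto_shift (f := fun L => (i L : ℝ) * δ) hxT (C * δ)
    (Eventually.of_forall fun L => by
      have : (i L : ℝ) * δ - x * (L * δ) = ((i L : ℝ) - x * L) * δ := by ring
      rw [this, abs_mul, abs_of_pos hδ]
      exact mul_le_mul_of_nonneg_right (hi L) hδ.le)
  have := ((huc.comp hiT).mul hs).mul ((ha.scale x hx).comp hT)
  rw [mul_one] at this
  refine this.congr' ?_
  filter_upwards [((tendsto_natCast_mul_atTop hδ).comp hiT).eventually ha.pos,
    hxT.eventually ha.pos] with L h1 h2
  simp only [Function.comp] at h1 ⊢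
  rw [div_mul_div_cancel₀ h1.ne', div_mul_div_cancel₀ h2.ne']

/-- Supplies the dominating constant for the convolution. Large indices are controlled by almost
monotonicity of `a`, the finitely many small ones by their sum `U`. -/
theorem exists_bound (ha : IsRegGrowth a α) (hδ : 0 < δ) (hu : ∀ i, 0 ≤ u i)
    (huc : Tendsto (fun i : ℕ => u i / a (i * δ)) atTop (𝓝 c)) :
    ∃ B : ℝ, 0 ≤ B ∧ ∀ᶠ L : ℕ in atTop, ∀ i ≤ L, u i / a (L * δ) ≤ B := by
  obtain ⟨K, Y, hK, hdom⟩ := ha.dom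
  have hT := tendsto_natCast_mul_atTop hδ
  obtain ⟨n, hn⟩ := eventually_atTop.1 ((huc.eventually (gt_mem_nhds (lt_add_one c))).and
    ((hT.eventually ha.pos).and (hT.eventually_ge_atTop Y)))
  have han := (hn n le_rfl).2.1
  set U := ∑ i ∈ Finset.range n, u i with hU
  have hU0 : 0 ≤ U := Finset.sum_nonneg fun i _ => hu i
  have hc0 : 0 ≤ c + 1 :=
    (div_nonneg (hu n) han.le).trans (hn n le_rfl).1.le
  refine ⟨U * K / a (n * δ) + (c + 1) * K, by positivity, ?_⟩
  filter_upwards [eventually_ge_atTop n] with L hL i hi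
  have haL := (hn L hL).2.1
  rw [div_le_iff₀ haL, add_mul]
  rcases lt_or_ge i n with h | h
  · have h1 : u i ≤ U := Finset.single_le_sum (fun i _ => hu i) (Finset.mem_range.2 h)
    have h2 : a (n * δ) ≤ K * a (L * δ) :=
      hdom _ _ (hn n le_rfl).2.2 (by gcongr)
    have h3 : U ≤ U * K / a (n * δ) * a (L * δ) := by
      rw [div_mul_eq_mul_div, le_div_iff₀ han, mul_assoc]
      exact mul_le_mul_of_nonneg_left h2 hU0
    have : 0 ≤ (c + 1) * K * a (L * δ) := by positivity
    linarith
  · obtain ⟨h1, h2, h3⟩ := hn i h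
    rw [div_lt_iff₀ h2] at h1
    have h4 : a (i * δ) ≤ K * a (L * δ) := hdom _ _ h3 (by gcongr)
    have h5 : (c + 1) * a (i * δ) ≤ (c + 1) * K * a (L * δ) := by
      rw [mul_assoc]; exact mul_le_mul_of_nonneg_left h4 hc0
    have : 0 ≤ U * K / a (n * δ) * a (L * δ) := by positivity
    linarith

/-- Asymptotics of the convolution of two sequences of regular growth. -/
theorem tendsto_convolution (ha : IsRegGrowth a α) {b : ℝ → ℝ} {β c' : ℝ} {v : ℕ → ℝ}
    (hb : IsRegGrowth b β) (hα : 0 ≤ α) (hβ : 0 ≤ β) (hδ : 0 < δ)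
    (hu : ∀ i, 0 ≤ u i) (hv : ∀ i, 0 ≤ v i)
    (huc : Tendsto (fun i : ℕ => u i / a (i * δ)) atTop (𝓝 c))
    (hvc : Tendsto (fun i : ℕ => v i / b (i * δ)) atTop (𝓝 c')) :
    Tendsto (fun L : ℕ => (∑ i ∈ Finset.range (L + 1), u i * v (L - i)) /
        (((L : ℝ) + 1) * (a (L * δ) * b (L * δ)))) atTop
      (𝓝 (c * c' * (Real.Gamma (α + 1) * Real.Gamma (β + 1) /
        Real.Gamma (α + 1 + (β + 1))))) := by
  obtain ⟨A, hA0, hA⟩ := ha.exists_bound hδ hu huc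
  obtain ⟨B, hB0, hB⟩ := hb.exists_bound hδ hv hvc
  have hT := tendsto_natCast_mul_atTop hδ
  -- At `x = 1` the index `⌊(L + 1) x⌋₊` is `L + 1`, outside the range of summation.
  have hne : ∀ᵐ x : ℝ, x ≠ 1 := by simp [ae_iff]
  have hfl : ∀ x : ℝ, x ∈ uIoc (0 : ℝ) 1 → x ≠ 1 → ∀ L : ℕ,
      0 < x ∧ x < 1 ∧ ⌊((L : ℝ) + 1) * x⌋₊ ≤ L := by
    intro x hx hx1 L
    rw [uIoc_of_le zero_le_one] at hx
    have hlt : x < 1 := lt_of_le_of_ne hx.2 hx1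
    refine ⟨hx.1, hlt, Nat.lt_succ_iff.1 ?_⟩
    rw [Nat.floor_lt (by have := hx.1; positivity)]
    push_cast
    exact mul_lt_of_lt_one_right (by positivity) hlt
  have key := intervalIntegral.tendsto_integral_filter_of_dominated_convergence
    (μ := volume) (a := 0) (b := 1) (l := (atTop : Filter ℕ))
    (F := fun L x => u ⌊((L : ℝ) + 1) * x⌋₊ / a (L * δ) *
      (v (L - ⌊((L : ℝ) + 1) * x⌋₊) / b (L * δ)))
    (f := fun x => c * c' * (x ^ α * (1 - x) ^ β)) (fun _ => A * B)
    (Eventually.of_forall fun L => by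
      have : Measurable fun x : ℝ => ⌊((L : ℝ) + 1) * x⌋₊ :=
        Nat.measurable_floor.comp (measurable_const.mul measurable_id)
      exact ((measurable_from_nat (f := fun i => u i / a (L * δ) *
        (v (L - i) / b (L * δ)))).comp this).aestronglyMeasurable)
    (by
      filter_upwards [hA, hB, hT.eventually ha.pos, hT.eventually hb.pos] with L h1 h2 h3 h4
      filter_upwards [hne] with x hx1 hx
      obtain ⟨-, -, h5⟩ := hfl x hx hx1 L
      have p1 := div_nonneg (hu ⌊((L : ℝ) + 1) * x⌋₊) h3.le
      have p2 := div_nonneg (hv (L - ⌊((L : ℝ) + 1) * x⌋₊)) h4.le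
      rw [Real.norm_of_nonneg (mul_nonneg p1 p2)]
      exact mul_le_mul (h1 _ h5) (h2 _ (Nat.sub_le _ _)) p2 hA0)
    intervalIntegrable_const
    (by
      filter_upwards [hne] with x hx1 hx
      have hx0 := (hfl x hx hx1 0).1
      have hx2 := (hfl x hx hx1 0).2.1
      have habs : ∀ L : ℕ, |(⌊((L : ℝ) + 1) * x⌋₊ : ℝ) - x * L| ≤ 2 := fun L => by
        have g1 := Nat.floor_le (show 0 ≤ ((L : ℝ) + 1) * x by positivity)
        have g2 := Nat.lt_floor_add_one (((L : ℝ) + 1) * x)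
        rw [abs_le]
        constructor <;> nlinarith
      have l1 := ha.tendsto_seq hδ huc hx0 habs
      have l2 := hb.tendsto_seq hδ hvc (sub_pos.2 hx2) (C := 2)
        (i := fun L : ℕ => L - ⌊((L : ℝ) + 1) * x⌋₊) (fun L => by
          rw [Nat.cast_sub (hfl x hx hx1 L).2.2, abs_sub_comm]
          refine le_of_eq_of_le ?_ (habs L)
          congr 1
          ring)
      convert l1.mul l2 using 2
      ring)
  rw [intervalIntegral.integral_const_mul, integral_rpow_mul_one_sub_rpow hα hβ] at key
  refine key.congr fun L => ?_
  rw [integral_floor_eq_sum (fun i => u i / a (L * δ) * (v (L - i) / b (L * δ))) L]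
  simp only [div_mul_div_comm]
  rw [← Finset.sum_div, div_div, mul_comm (a _ * b _)]

end IsRegGrowth

/-! ### Counting functions and diagonals of cells -/

/-- The number of indices `r` with `S r ≤ y`. -/
noncomputable def levelCount {ι : Type*} (S : ι → ℝ) (y : ℝ) : ℝ :=
  ({r | S r ≤ y}.ncard : ℝ)

/-- Nonnegative families with finite sublevel sets. -/
structure IsProper {ι : Type*} (S : ι → ℝ) : Prop where
  nonneg : ∀ r, 0 ≤ S r
  finite : ∀ y, {r | S r ≤ y}.Finite

/-- `M (y + h) - M y` is asymptotically `C * h * a y`, for every `h`. -/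
def HasIncrements (M a : ℝ → ℝ) (C : ℝ) : Prop :=
  ∀ h, Tendsto (fun y => (M (y + h) - M y) / a y) atTop (𝓝 (C * h))

theorem levelCount_comp_equiv {ι κ : Type*} (S : κ → ℝ) (e : ι ≃ κ) (y : ℝ) :
    levelCount (S ∘ e) y = levelCount S y := by
  unfold levelCount
  have : {r | (S ∘ e) r ≤ y} = e ⁻¹' {r | S r ≤ y} := rfl
  rw [this, Set.ncard_preimage_of_injective_subset_range e.injective (by simp)]

theorem ncard_eq_sum_fiber {X : Type*} {s : Set X} (hs : s.Finite) (f : X → ℕ) (F : Finset ℕ)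
    (hF : ∀ x ∈ s, f x ∈ F) : s.ncard = ∑ l ∈ F, {x | x ∈ s ∧ f x = l}.ncard := by
  classical
  rw [Set.ncard_eq_toFinset_card s hs,
    Finset.card_eq_sum_card_fiberwise (f := f) (t := F) (fun x hx => hF x (by simpa using hx))]
  refine Finset.sum_congr rfl fun l _ => ?_
  rw [← Set.ncard_coe_finset]
  congr 1
  ext x
  simp

namespace IsProper

variable {ι κ : Type*} {S : ι → ℝ} {T : κ → ℝ}

theorem add (hS : IsProper S) (hT : IsProper T) : IsProper (fun q : ι × κ => S q.1 + T q.2) where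
  nonneg q := add_nonneg (hS.nonneg _) (hT.nonneg _)
  finite y := ((hS.finite y).prod (hT.finite y)).subset fun q hq => by
    have h1 := hS.nonneg q.1
    have h2 := hT.nonneg q.2
    simp only [mem_ofPred_eq] at hq
    simp only [mem_prod, mem_ofPred_eq]
    constructor <;> linarith

theorem levelCount_mono (hS : IsProper S) : Monotone (levelCount S) := fun y z hyz => by
  unfold levelCount
  exact_mod_cast Set.ncard_le_ncard (fun r (hr : S r ≤ y) => hr.trans hyz) (hS.finite z)

theorem levelCount_of_neg (hS : IsProper S) {y : ℝ} (hy : y < 0) : levelCount S y = 0 := by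
  have : {r | S r ≤ y} = ∅ := by
    ext r
    simpa using hy.trans_le (hS.nonneg r)
  simp [levelCount, this]

theorem levelCount_sub (hS : IsProper S) {y z : ℝ} (hyz : y ≤ z) :
    levelCount S z - levelCount S y = ({r | y < S r ∧ S r ≤ z}.ncard : ℝ) := by
  have hsub : {r | S r ≤ y} ⊆ {r | S r ≤ z} := fun r (hr : S r ≤ y) => hr.trans hyz
  have h := Set.ncard_sdiff_add_ncard_of_subset hsub (hS.finite z)
  have e : {r | S r ≤ z} \ {r | S r ≤ y} = {r | y < S r ∧ S r ≤ z} := by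
    ext r
    simp [and_comm]
  rw [e] at h
  unfold levelCount
  rw [← h]
  push_cast
  ring

/-- Cell 0 is the single value 0: the natural ceiling truncates there, and nonnegativity of `S`
keeps the formula valid. -/
theorem ceil_eq_iff (hS : IsProper S) {δ : ℝ} (hδ : 0 < δ) (r : ι) (i : ℕ) :
    ⌈S r / δ⌉₊ = i ↔ ((i : ℝ) - 1) * δ < S r ∧ S r ≤ i * δ := by
  have h0 := hS.nonneg r
  rcases eq_or_ne i 0 with rfl | hi
  · rw [Nat.ceil_eq_zero, div_le_iff₀ hδ]
    simp only [Nat.cast_zero]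
    constructor
    · intro h; exact ⟨by linarith, h⟩
    · exact fun h => h.2
  · rw [Nat.ceil_eq_iff hi, Nat.cast_pred (Nat.pos_of_ne_zero hi), lt_div_iff₀ hδ, div_le_iff₀ hδ]

theorem levelCount_cell (hS : IsProper S) {δ : ℝ} (hδ : 0 < δ) (i : ℕ) :
    levelCount S (i * δ) - levelCount S (((i : ℝ) - 1) * δ) =
      ({r | ⌈S r / δ⌉₊ = i}.ncard : ℝ) := by
  rw [hS.levelCount_sub (by nlinarith)]
  simp only [hS.ceil_eq_iff hδ]

theorem finite_diagonal (hS : IsProper S) (hT : IsProper T) {δ : ℝ} (hδ : 0 < δ) (l : ℕ) :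
    {q : ι × κ | ⌈S q.1 / δ⌉₊ + ⌈T q.2 / δ⌉₊ = l}.Finite := by
  refine ((hS.add hT).finite (l * δ)).subset fun q hq => ?_
  have h1 := ((hS.ceil_eq_iff hδ q.1 _).1 rfl).2
  have h2 := ((hT.ceil_eq_iff hδ q.2 _).1 rfl).2
  simp only [mem_ofPred_eq] at hq ⊢
  rw [← hq]
  push_cast
  linarith

theorem ncard_diagonal (hS : IsProper S) (hT : IsProper T) {δ : ℝ} (hδ : 0 < δ) (l : ℕ) :
    {q : ι × κ | ⌈S q.1 / δ⌉₊ + ⌈T q.2 / δ⌉₊ = l}.ncard =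
      ∑ i ∈ Finset.range (l + 1),
        {r | ⌈S r / δ⌉₊ = i}.ncard * {k | ⌈T k / δ⌉₊ = l - i}.ncard := by
  rw [ncard_eq_sum_fiber (hS.finite_diagonal hT hδ l) (fun q => ⌈S q.1 / δ⌉₊)
    (Finset.range (l + 1)) (fun q hq => by
      simp only [mem_ofPred_eq] at hq
      simp only [Finset.mem_range]
      omega)]
  refine Finset.sum_congr rfl fun i hi => ?_
  rw [← Set.ncard_prod]
  congr 1
  ext q
  have := Finset.mem_range.1 hi
  simp only [mem_ofPred_eq, mem_prod]
  omega

/-- The sum of two exponents on diagonal `l` lies in `((l - 2) δ, l δ]`, so every pair counted on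
the left has `l` between `p` and `q`. -/
theorem levelCount_add_sub_le (hS : IsProper S) (hT : IsProper T) {δ : ℝ} (hδ : 0 < δ)
    {y z : ℝ} (hyz : y ≤ z) {p q : ℕ} (hp : ((p : ℝ) - 1) * δ ≤ y) (hq : z ≤ ((q : ℝ) - 1) * δ) :
    levelCount (fun x : ι × κ => S x.1 + T x.2) z - levelCount (fun x : ι × κ => S x.1 + T x.2) y ≤
      ∑ l ∈ Finset.Icc p q, ({x : ι × κ | ⌈S x.1 / δ⌉₊ + ⌈T x.2 / δ⌉₊ = l}.ncard : ℝ) := by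
  have hfin : {x : ι × κ | y < S x.1 + T x.2 ∧ S x.1 + T x.2 ≤ z}.Finite :=
    ((hS.add hT).finite z).subset fun x hx => hx.2
  rw [(hS.add hT).levelCount_sub hyz,
    ncard_eq_sum_fiber hfin (fun x => ⌈S x.1 / δ⌉₊ + ⌈T x.2 / δ⌉₊) (Finset.Icc p q)
    (fun x hx => by
      obtain ⟨h1, h2⟩ := (hS.ceil_eq_iff hδ x.1 _).1 rfl
      obtain ⟨h3, h4⟩ := (hT.ceil_eq_iff hδ x.2 _).1 rfl
      obtain ⟨h5, h6⟩ := hx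
      set i := ⌈S x.1 / δ⌉₊
      set k := ⌈T x.2 / δ⌉₊
      have g1 : ((p : ℝ) - 1) * δ < ((i : ℝ) + k) * δ := by linarith
      have g2 : ((i : ℝ) + k - 2) * δ < ((q : ℝ) - 1) * δ := by linarith
      replace g1 := lt_of_mul_lt_mul_right g1 hδ.le
      replace g2 := lt_of_mul_lt_mul_right g2 hδ.le
      have g3 : (p : ℝ) < ((i + k + 1 : ℕ) : ℝ) := by push_cast; linarith
      have g4 : ((i + k : ℕ) : ℝ) < ((q + 1 : ℕ) : ℝ) := by push_cast; linarith
      rw [Nat.cast_lt] at g3 g4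
      simp only [Finset.mem_Icc]
      omega)]
  push_cast
  refine Finset.sum_le_sum fun l _ => ?_
  exact_mod_cast Set.ncard_le_ncard
    (t := {x : ι × κ | ⌈S x.1 / δ⌉₊ + ⌈T x.2 / δ⌉₊ = l})
    (fun x hx => (show _ ∧ _ from hx).2) (hS.finite_diagonal hT hδ l)

theorem le_levelCount_add_sub (hS : IsProper S) (hT : IsProper T) {δ : ℝ} (hδ : 0 < δ)
    {y z : ℝ} (hyz : y ≤ z) {p q : ℕ} (hp : y ≤ ((p : ℝ) - 2) * δ) (hq : q * δ ≤ z) :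
    ∑ l ∈ Finset.Icc p q, ({x : ι × κ | ⌈S x.1 / δ⌉₊ + ⌈T x.2 / δ⌉₊ = l}.ncard : ℝ) ≤
      levelCount (fun x : ι × κ => S x.1 + T x.2) z -
        levelCount (fun x : ι × κ => S x.1 + T x.2) y := by
  have hfin : {x : ι × κ | y < S x.1 + T x.2 ∧ S x.1 + T x.2 ≤ z}.Finite :=
    ((hS.add hT).finite z).subset fun x hx => hx.2
  set U : Set (ι × κ) := {x | ⌈S x.1 / δ⌉₊ + ⌈T x.2 / δ⌉₊ ∈ Finset.Icc p q} with hU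
  have hsub : U ⊆ {x : ι × κ | y < S x.1 + T x.2 ∧ S x.1 + T x.2 ≤ z} := by
    intro x hx
    obtain ⟨h1, h2⟩ := (hS.ceil_eq_iff hδ x.1 _).1 rfl
    obtain ⟨h3, h4⟩ := (hT.ceil_eq_iff hδ x.2 _).1 rfl
    simp only [hU, mem_ofPred_eq, Finset.mem_Icc] at hx
    obtain ⟨h5, h6⟩ := hx
    set i := ⌈S x.1 / δ⌉₊
    set k := ⌈T x.2 / δ⌉₊
    have g1 : (p : ℝ) ≤ (i : ℝ) + k := by exact_mod_cast h5
    have g2 : (i : ℝ) + k ≤ q := by exact_mod_cast h6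
    have g3 := mul_le_mul_of_nonneg_right g1 hδ.le
    have g4 := mul_le_mul_of_nonneg_right g2 hδ.le
    constructor <;> linarith
  rw [(hS.add hT).levelCount_sub hyz]
  have h := ncard_eq_sum_fiber (hfin.subset hsub) (fun x => ⌈S x.1 / δ⌉₊ + ⌈T x.2 / δ⌉₊)
    (Finset.Icc p q) (fun x hx => hx)
  have h2 : ∑ l ∈ Finset.Icc p q, {x : ι × κ | ⌈S x.1 / δ⌉₊ + ⌈T x.2 / δ⌉₊ = l}.ncard = U.ncard := by
    rw [h]
    refine Finset.sum_congr rfl fun l hl => ?_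
    congr 1
    ext x
    simp only [hU, mem_ofPred_eq]
    exact ⟨fun e => ⟨e ▸ hl, e⟩, fun e => e.2⟩
  exact_mod_cast h2.trans_le (Set.ncard_le_ncard hsub hfin)

end IsProper

/-! ### Increments of counting functions -/

namespace HasIncrements

variable {M a : ℝ → ℝ} {C α : ℝ}

theorem of_pos (ha : IsRegGrowth a α)
    (hM : ∀ h, 0 < h → Tendsto (fun y => (M (y + h) - M y) / a y) atTop (𝓝 (C * h))) :
    HasIncrements M a C := by
  intro h
  rcases lt_trichotomy h 0 with hh | rfl | hh
  -- A negative increment is a positive one read from the base point `y + h`, and `a (y + h) ~ a y`.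
  · have hT : Tendsto (fun y : ℝ => y + h) atTop atTop :=
      tendsto_atTop_add_const_right _ _ tendsto_id
    have h1 := (hM (-h) (by linarith)).comp hT
    have h2 := ha.tendsto_shift (f := fun y : ℝ => y + h) (k := fun y : ℝ => y) tendsto_id |h|
      (Eventually.of_forall fun y => by simp)
    have h3 := (h1.mul h2).neg
    convert h3.congr' ?_ using 2
    · ring
    · filter_upwards [hT.eventually ha.pos] with y hy
      simp only [Function.comp]
      rw [div_mul_div_cancel₀ hy.ne', add_neg_cancel_right, ← neg_div, neg_sub]
  · simp
  · exact hM h hh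

theorem tendsto_cell (hM : HasIncrements M a C) {δ : ℝ} (hδ : 0 < δ) :
    Tendsto (fun i : ℕ => (M (i * δ) - M (((i : ℝ) - 1) * δ)) / a (i * δ)) atTop
      (𝓝 (C * δ)) := by
  have h := ((hM (-δ)).comp (tendsto_natCast_mul_atTop hδ)).neg
  convert h using 2 with i
  · simp only [Function.comp]
    rw [← neg_div, neg_sub]
    congr 4
    ring
  · ring

/-- Karamata's theorem: integrating the increments. -/
theorem tendsto_total (hM : HasIncrements M a C) (ha : IsRegGrowth a α) (hα : 0 ≤ α)
    (hmono : Monotone M) (hneg : ∀ y < 0, M y = 0) :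
    Tendsto (fun y => M y / (y * a y)) atTop
      (𝓝 (C * (Real.Gamma (α + 1) / Real.Gamma (α + 1 + 1)))) := by
  -- Convolving the unit increments with the constant sequence 1 makes the sum telescope to `M L`,
  -- as `M (-1) = 0`.
  have hc := ha.tendsto_convolution IsRegGrowth.const_one (δ := 1)
    (u := fun i => M (i * 1) - M (((i : ℝ) - 1) * 1)) (v := fun _ => 1) (c' := 1) hα le_rfl one_pos
    (fun i => sub_nonneg.2 (hmono (by linarith))) (fun _ => zero_le_one)
    (hM.tendsto_cell one_pos) (by simp)
  have hsum : ∀ L : ℕ, ∑ i ∈ Finset.range (L + 1), (M i - M ((i : ℝ) - 1)) = M L := by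
    intro L
    induction L with
    | zero => simp [hneg]
    | succ L ih => rw [Finset.sum_range_succ, ih]; push_cast; simp
  simp only [mul_one, zero_add, Real.Gamma_one, hsum] at hc
  set G : ℝ → ℝ := fun y => y * a y with hG
  have hGr : IsRegGrowth G (1 + α) := IsRegGrowth.id.mul ha
  have hnat := tendsto_natCast_atTop_atTop (R := ℝ)
  have hL : Tendsto (fun L : ℕ => M L / G L) atTop
      (𝓝 (C * (Real.Gamma (α + 1) / Real.Gamma (α + 1 + 1)))) := by
    have h1 : Tendsto (fun L : ℕ => ((L : ℝ) + 1) / (L : ℝ)) atTop (𝓝 1) :=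
      IsRegGrowth.id.tendsto_shift (f := fun L : ℕ => (L : ℝ) + 1) hnat 1
        (Eventually.of_forall fun L => by simp)
    have h2 := hc.mul h1
    rw [mul_one] at h2
    refine h2.congr fun L => ?_
    have : ((L : ℝ) + 1) ≠ 0 := by positivity
    rw [div_mul_div_comm, mul_comm (M L), mul_assoc, mul_div_mul_left _ _ this, hG, mul_comm (a _)]
  have hfl : Tendsto (fun y : ℝ => ⌊y⌋₊) atTop atTop := tendsto_nat_floor_atTop
  have hev : ∀ᶠ y : ℝ in atTop, ((⌊y⌋₊ : ℝ) ≤ y ∧ y ≤ ((⌊y⌋₊ + 1 : ℕ) : ℝ)) := by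
    filter_upwards [eventually_ge_atTop 0] with y hy
    exact ⟨Nat.floor_le hy, by push_cast; exact (Nat.lt_floor_add_one y).le⟩
  have hfl1 : Tendsto (fun y : ℝ => ⌊y⌋₊ + 1) atTop atTop :=
    (tendsto_add_atTop_nat 1).comp hfl
  have hlow := (hL.comp hfl).mul (hGr.tendsto_shift (f := fun y : ℝ => (⌊y⌋₊ : ℝ))
    (k := fun y => y) tendsto_id 1 (hev.mono fun y hy => by
      have := hy.1; have := hy.2; push_cast at this
      rw [abs_le]; constructor <;> linarith))
  have hup := (hL.comp hfl1).mul (hGr.tendsto_shift (f := fun y : ℝ => ((⌊y⌋₊ + 1 : ℕ) : ℝ))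
    (k := fun y => y) tendsto_id 1 (hev.mono fun y hy => by
      have := hy.1; have := hy.2; push_cast at this ⊢
      rw [abs_le]; constructor <;> linarith))
  rw [mul_one] at hlow hup
  refine tendsto_of_tendsto_of_tendsto_of_le_of_le' hlow hup ?_ ?_
  · filter_upwards [hev, hGr.pos, (hnat.comp hfl).eventually hGr.pos] with y h1 h2 h3
    simp only [Function.comp] at h3 ⊢
    rw [div_mul_div_cancel₀ h3.ne']
    exact div_le_div_of_nonneg_right (hmono h1.1) h2.le
  · filter_upwards [hev, hGr.pos, (hnat.comp hfl1).eventually hGr.pos] with y h1 h2 h3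
    simp only [Function.comp] at h3 ⊢
    rw [div_mul_div_cancel₀ h3.ne']
    exact div_le_div_of_nonneg_right (hmono h1.2) h2.le

/-- Increments of the counting function of a sum of two independent indices. -/
theorem levelCount_add {ι κ : Type*} {S : ι → ℝ} {T : κ → ℝ} (hS : IsProper S) (hT : IsProper T)
    {b : ℝ → ℝ} {β C' : ℝ} (ha : IsRegGrowth a α) (hb : IsRegGrowth b β) (hα : 0 ≤ α) (hβ : 0 ≤ β)
    (hSi : HasIncrements (levelCount S) a C) (hTi : HasIncrements (levelCount T) b C') :
    HasIncrements (levelCount (fun q : ι × κ => S q.1 + T q.2)) (fun y => y * (a y * b y))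
      (C * C' * (Real.Gamma (α + 1) * Real.Gamma (β + 1) / Real.Gamma (α + 1 + (β + 1)))) := by
  set G : ℝ → ℝ := fun y => y * (a y * b y) with hG
  have hGr : IsRegGrowth G (1 + (α + β)) := IsRegGrowth.id.mul (ha.mul hb)
  set c := C * C' * (Real.Gamma (α + 1) * Real.Gamma (β + 1) / Real.Gamma (α + 1 + (β + 1))) with hc
  refine of_pos hGr fun h hh => ?_
  set N := levelCount (fun q : ι × κ => S q.1 + T q.2) with hN
  set D : ℝ → ℕ → ℝ := fun δ l =>
    ({x : ι × κ | ⌈S x.1 / δ⌉₊ + ⌈T x.2 / δ⌉₊ = l}.ncard : ℝ) with hD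
  have hDlim : ∀ δ, 0 < δ → Tendsto (fun l : ℕ => D δ l / G (l * δ)) atTop (𝓝 (c * δ)) := by
    intro δ hδ
    have h1 := ha.tendsto_convolution hb hα hβ hδ
      (u := fun i => ({r | ⌈S r / δ⌉₊ = i}.ncard : ℝ))
      (v := fun i => ({k | ⌈T k / δ⌉₊ = i}.ncard : ℝ)) (fun _ => Nat.cast_nonneg _)
      (fun _ => Nat.cast_nonneg _)
      (by simpa only [hS.levelCount_cell hδ] using hSi.tendsto_cell hδ)
      (by simpa only [hT.levelCount_cell hδ] using hTi.tendsto_cell hδ)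
    have h2 : Tendsto (fun l : ℕ => ((l : ℝ) + 1) / (l : ℝ)) atTop (𝓝 1) :=
      IsRegGrowth.id.tendsto_shift (f := fun l : ℕ => (l : ℝ) + 1) tendsto_natCast_atTop_atTop 1
        (Eventually.of_forall fun l => by simp)
    have h3 := (h1.mul h2).div_const δ
    -- Each sequence of cell counts contributes a factor `δ`; one of them is spent on the factor `l
    -- * δ` of `G (l * δ)`.
    have e : C * δ * (C' * δ) * (Real.Gamma (α + 1) * Real.Gamma (β + 1) /
        Real.Gamma (α + 1 + (β + 1))) * 1 / δ = c * δ := by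
      rw [hc]; field_simp
    rw [e] at h3
    refine h3.congr fun l => ?_
    have hl : ((l : ℝ) + 1) ≠ 0 := by positivity
    have h4 : D δ l = ∑ i ∈ Finset.range (l + 1), ({r | ⌈S r / δ⌉₊ = i}.ncard : ℝ) *
        ({k | ⌈T k / δ⌉₊ = l - i}.ncard : ℝ) := by
      simp only [hD]
      rw [hS.ncard_diagonal hT hδ l]
      push_cast
      rfl
    rw [← h4, div_mul_div_comm, mul_comm (D δ l), mul_assoc, mul_div_mul_left _ _ hl, div_div, hG]
    congr 1
    ring
  have hsumlim : ∀ δ, 0 < δ → ∀ F : Finset ℕ,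
      Tendsto (fun y : ℝ => (∑ s ∈ F, D δ (⌊y / δ⌋₊ + s)) / G y) atTop
        (𝓝 (F.card * (c * δ))) := by
    intro δ hδ F
    simp only [Finset.sum_div]
    rw [← nsmul_eq_mul, ← Finset.sum_const]
    refine tendsto_finsetSum _ fun s _ => ?_
    have hfl : Tendsto (fun y : ℝ => ⌊y / δ⌋₊ + s) atTop atTop :=
      (tendsto_add_atTop_nat s).comp
        (tendsto_nat_floor_atTop.comp (tendsto_id.atTop_div_const hδ))
    have h1 := (hDlim δ hδ).comp hfl
    have h2 := hGr.tendsto_shift (f := fun y : ℝ => ((⌊y / δ⌋₊ + s : ℕ) : ℝ) * δ)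
      (k := fun y => y) tendsto_id ((s + 1) * δ) (by
        filter_upwards [eventually_ge_atTop 0] with y hy
        have g1 := Nat.floor_le (div_nonneg hy hδ.le)
        have g2 := Nat.lt_floor_add_one (y / δ)
        rw [le_div_iff₀ hδ] at g1
        rw [div_lt_iff₀ hδ] at g2
        have g3 : 0 ≤ (s : ℝ) * δ := by positivity
        push_cast
        rw [abs_le]
        constructor <;> nlinarith)
    have h3 := h1.mul h2
    rw [mul_one] at h3
    refine h3.congr' ?_
    filter_upwards [((tendsto_natCast_mul_atTop hδ).comp hfl).eventually hGr.pos] with y hy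
    simp only [Function.comp] at hy ⊢
    rw [div_mul_div_cancel₀ hy.ne']
  have hshiftsum : ∀ δ p q m, ∑ l ∈ Finset.Icc (m + p) (m + q), D δ l =
      ∑ s ∈ Finset.Icc p q, D δ (m + s) := fun δ p q m => by
    rw [← Finset.map_add_left_Icc, Finset.sum_map]; rfl
  have hgrid : ∀ δ, 0 < δ → ∀ᶠ y : ℝ in atTop, (⌊y / δ⌋₊ : ℝ) * δ ≤ y ∧
      y < ((⌊y / δ⌋₊ : ℝ) + 1) * δ := by
    intro δ hδ
    filter_upwards [eventually_ge_atTop 0] with y hy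
    exact ⟨(le_div_iff₀ hδ).1 (Nat.floor_le (div_nonneg hy hδ.le)),
      (div_lt_iff₀ hδ).1 (Nat.lt_floor_add_one _)⟩
  have hcn : Tendsto (fun n : ℕ => (n : ℝ)⁻¹) atTop (𝓝 0) := tendsto_inv_atTop_nhds_zero_nat
  have hlowlim : Tendsto (fun n : ℕ => (1 - 2 * (n : ℝ)⁻¹) * (c * h)) atTop (𝓝 (c * h)) := by
    simpa using ((hcn.const_mul 2).const_sub 1).mul_const (c * h)
  have huplim : Tendsto (fun n : ℕ => (1 + 2 * (n : ℝ)⁻¹) * (c * h)) atTop (𝓝 (c * h)) := by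
    simpa using ((hcn.const_mul 2).const_add 1).mul_const (c * h)
  refine tendsto_order.2 ⟨fun x hx => ?_, fun x hx => ?_⟩
  · obtain ⟨n, hn1, hn2⟩ := ((hlowlim.eventually (lt_mem_nhds hx)).and
      (eventually_ge_atTop 2)).exists
    have hn0 : (0 : ℝ) < n := by exact_mod_cast (by omega : 0 < n)
    have hδ : 0 < h / n := by positivity
    have hnδ : (n : ℝ) * (h / n) = h := by field_simp
    -- With `m = ⌊y / δ⌋₊`, diagonals `m + 3` to `m + n` lie inside: `y ≤ (m + 1) δ` and `(m + n) δ
    -- ≤ y + h`.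
    have hl := hsumlim (h / n) hδ (Finset.Icc 3 n)
    have e : ((Finset.Icc 3 n).card : ℝ) * (c * (h / n)) = (1 - 2 * (n : ℝ)⁻¹) * (c * h) := by
      have hcard : (Finset.Icc 3 n).card = n - 2 := by rw [Nat.card_Icc]; omega
      rw [hcard, Nat.cast_sub hn2]
      push_cast
      field_simp
    rw [e] at hl
    filter_upwards [hl.eventually (lt_mem_nhds hn1), hgrid (h / n) hδ, hGr.pos] with y h1 h2 h3
    refine h1.trans_le (div_le_div_of_nonneg_right ?_ h3.le)
    rw [← hshiftsum]
    refine hS.le_levelCount_add_sub hT hδ (by linarith) ?_ ?_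
    · push_cast
      linarith [h2.2]
    · push_cast
      linarith [h2.1]
  · obtain ⟨n, hn1, hn2⟩ := ((huplim.eventually (gt_mem_nhds hx)).and
      (eventually_ge_atTop 2)).exists
    have hn0 : (0 : ℝ) < n := by exact_mod_cast (by omega : 0 < n)
    have hδ : 0 < h / n := by positivity
    have hnδ : (n : ℝ) * (h / n) = h := by field_simp
    -- Diagonals `m + 1` to `m + n + 2` cover the increment: `m δ ≤ y` and `y + h ≤ (m + n + 1) δ`.
    have hl := hsumlim (h / n) hδ (Finset.Icc 1 (n + 2))
    have e : ((Finset.Icc 1 (n + 2)).card : ℝ) * (c * (h / n)) = (1 + 2 * (n : ℝ)⁻¹) * (c * h) := by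
      rw [Nat.card_Icc, Nat.add_sub_cancel]
      push_cast
      field_simp
    rw [e] at hl
    filter_upwards [hl.eventually (gt_mem_nhds hn1), hgrid (h / n) hδ, hGr.pos] with y h1 h2 h3
    refine lt_of_le_of_lt (div_le_div_of_nonneg_right ?_ h3.le) h1
    rw [← hshiftsum]
    refine hS.levelCount_add_sub_le hT hδ (by linarith) ?_ ?_
    · push_cast
      linarith [h2.1]
    · push_cast
      linarith [h2.2]

end HasIncrements

/-! ### Generations of the nested scheme -/

theorem isRegGrowth_pow {g : ℝ → ℝ} {β : ℝ} (hg : IsRegGrowth g β) (n : ℕ) :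
    IsRegGrowth (fun y => y ^ n * g y ^ (n + 1)) (((n : ℝ) + 1) * (β + 1) - 1) := by
  induction n with
  | zero => simpa using hg
  | succ n ih =>
    convert IsRegGrowth.id.mul (hg.mul ih) using 1
    · funext y; ring
    · push_cast; ring

section Generations

variable {p : ℕ → ℝ}

/-- The exponent `-log p_r` of an individual `r` of positive weight. -/
noncomputable def logWeight (p : ℕ → ℝ) {j : ℕ} (r : Fin j → {k // 0 < p k}) : ℝ :=
  ∑ i, -Real.log (p (r i))

theorem logWeight_le_iff {j : ℕ} (r : Fin j → {k // 0 < p k}) (y : ℝ) :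
    logWeight p r ≤ y ↔ 1 / Real.exp y ≤ weight p fun i => (r i : ℕ) := by
  have hpos : 0 < weight p fun i => (r i : ℕ) := Finset.prod_pos fun i _ => (r i).2
  have e : logWeight p r = -Real.log (weight p fun i => (r i : ℕ)) := by
    rw [weight, Real.log_prod fun i _ => (r i).2.ne', logWeight, Finset.sum_neg_distrib]
  rw [e, one_div, ← Real.exp_neg, ← Real.le_log_iff_exp_le hpos, neg_le]

theorem isProper_logWeight (hp0 : ∀ k, 0 ≤ p k) (hp1 : HasSum p 1) (j : ℕ) :
    IsProper (logWeight p (j := j)) where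
  nonneg r := Finset.sum_nonneg fun i _ => neg_nonneg.2
    (Real.log_nonpos (hp0 _) (le_hasSum hp1 _ fun i _ => hp0 i))
  finite y := by
    have h := (finite_weight_ge hp0 hp1 j (Real.exp_pos y)).preimage
      (f := fun (r : Fin j → {k // 0 < p k}) i => (r i : ℕ))
      (fun r _ s _ h => funext fun i => Subtype.ext (congrFun h i))
    exact h.subset fun r hr => (logWeight_le_iff r y).1 hr

/-- A word using a letter of probability zero has weight `0 < exp (-y)` and is never counted, so
restricting to positive letters, where the logarithm is meaningful, loses nothing. -/
theorem rhoGen_exp (hp0 : ∀ k, 0 ≤ p k) (j : ℕ) (y : ℝ) :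
    rhoGen p j (Real.exp y) = levelCount (logWeight p (j := j)) y := by
  have hinj : Function.Injective fun (r : Fin j → {k // 0 < p k}) i => (r i : ℕ) :=
    fun r s h => funext fun i => Subtype.ext (congrFun h i)
  have e : {r : Fin j → ℕ | 1 / Real.exp y ≤ weight p r} =
      (fun (r : Fin j → {k // 0 < p k}) i => (r i : ℕ)) '' {r | logWeight p r ≤ y} := by
    ext r
    constructor
    · intro hr
      have hw : 0 < weight p r := (one_div_pos.2 (Real.exp_pos y)).trans_le hr
      have hr0 : ∀ i, 0 < p (r i) := fun i =>
        (hp0 _).lt_of_ne' (Finset.prod_ne_zero_iff.1 hw.ne' i (Finset.mem_univ i))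
      exact ⟨fun i => ⟨r i, hr0 i⟩, (logWeight_le_iff _ y).2 hr, rfl⟩
    · rintro ⟨s, hs, rfl⟩
      exact (logWeight_le_iff s y).1 hs
  rw [rhoGen, levelCount, e, Set.ncard_image_of_injective _ hinj]

theorem levelCount_logWeight_succ (n : ℕ) (y : ℝ) :
    levelCount (logWeight p (j := n + 2)) y =
      levelCount (fun q : (Fin 1 → {k // 0 < p k}) × (Fin (n + 1) → {k // 0 < p k}) =>
        logWeight p q.1 + logWeight p q.2) y := by
  set e : (Fin (n + 2) → {k // 0 < p k}) ≃
      (Fin 1 → {k // 0 < p k}) × (Fin (n + 1) → {k // 0 < p k}) :=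
    (Fin.consEquiv fun _ => {k // 0 < p k}).symm.trans
      ((Equiv.funUnique (Fin 1) {k // 0 < p k}).symm.prodCongr (Equiv.refl _)) with he
  rw [← levelCount_comp_equiv _ e]
  congr 1
  funext r
  simp [he, logWeight, Fin.sum_univ_succ, Fin.consEquiv, Fin.tail, add_comm]

theorem hasIncrements_logWeight (hp0 : ∀ k, 0 ≤ p k) (hp1 : HasSum p 1) {g : ℝ → ℝ} {β : ℝ}
    (hβ : 0 ≤ β) (hg : IsRegGrowth g β)
    (h1 : HasIncrements (levelCount (logWeight p (j := 1))) g 1) (n : ℕ) :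
    HasIncrements (levelCount (logWeight p (j := n + 1))) (fun y => y ^ n * g y ^ (n + 1))
      (Real.Gamma (β + 1) ^ (n + 1) / Real.Gamma (((n : ℝ) + 1) * (β + 1))) := by
  induction n with
  | zero =>
    have : Real.Gamma (β + 1) ≠ 0 := (Real.Gamma_pos_of_pos (by linarith)).ne'
    simpa [div_self this] using h1
  | succ n ih =>
    have hα : 0 ≤ ((n : ℝ) + 1) * (β + 1) - 1 := by
      have := Nat.cast_nonneg (α := ℝ) n
      nlinarith
    have h := HasIncrements.levelCount_add (isProper_logWeight hp0 hp1 1)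
      (isProper_logWeight hp0 hp1 (n + 1)) hg (isRegGrowth_pow hg n) hβ hα h1 ih
    have hΓ : Real.Gamma (((n : ℝ) + 1) * (β + 1)) ≠ 0 :=
      (Real.Gamma_pos_of_pos (by linarith)).ne'
    rw [← funext (levelCount_logWeight_succ n)] at h
    convert h using 1
    -- The factor `Γ((n + 1)(β + 1))` from the Beta integral cancels the denominator of the
    -- induction hypothesis.
    · funext y; ring
    · rw [sub_add_cancel]
      have e : β + 1 + ((n : ℝ) + 1) * (β + 1) = (((n + 1 : ℕ) : ℝ) + 1) * (β + 1) := by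
        push_cast; ring
      rw [e]
      field_simp
      ring

end Generations

theorem IsSlowlyVarying.exists_pos_measurable_comp_log {ℓ : ℝ → ℝ} (hℓ : IsSlowlyVarying ℓ) (C α : ℝ)
    (j : ℕ) (hC : 0 < C) :
    ∃ X : ℝ, (∀ x, X ≤ x → 0 < C * (Real.log x ^ α * ℓ (Real.log x) ^ j)) ∧
      Measurable ((Ici X).domRestrict fun x => C * (Real.log x ^ α * ℓ (Real.log x) ^ j)) := by
  obtain ⟨X, hpos, hmeas⟩ := hℓ.1
  have hX : ∀ x, Real.exp (max X 1) ≤ x → max X 1 ≤ Real.log x := fun x hx =>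
    (Real.le_log_iff_exp_le ((Real.exp_pos _).trans_le hx)).2 hx
  refine ⟨Real.exp (max X 1), fun x hx => ?_, ?_⟩
  · have h1 := hX x hx
    have h2 : 0 < Real.log x := one_pos.trans_le ((le_max_right X 1).trans h1)
    have h3 := hpos _ ((le_max_left X 1).trans h1)
    positivity
  · have hlog : Measurable fun x : Ici (Real.exp (max X 1)) => Real.log x :=
      Real.measurable_log.comp measurable_subtype_coe
    have hl : Measurable fun x : Ici (Real.exp (max X 1)) => ℓ (Real.log x) :=
      hmeas.comp (hlog.subtype_mk (h := fun x =>
        (le_max_left X 1).trans (hX x x.2)))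
    exact measurable_const.mul ((hlog.pow_const α).mul (hl.pow_const j))

end NestedKarlin

/-! ### The main theorem -/

open NestedKarlin in
theorem proposition4p3
    (p : ℕ → ℝ) (hp_nonneg : ∀ k, 0 ≤ p k) (hp_sum : HasSum p 1)
    (hp_inf : {k : ℕ | 0 < p k}.Infinite)
    (β : ℝ) (hβ : 0 ≤ β)
    (ℓ : ℝ → ℝ) (hℓ : NestedKarlin.IsSlowlyVarying ℓ)
    (hβ_zero : β = 0 → NestedKarlin.EventuallyMonotoneUnbounded ℓ)
    (hρ : ∀ c : ℝ, 0 < c →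
      Tendsto (fun t : ℝ => (NestedKarlin.rho p (c * t) - NestedKarlin.rho p t) /
          ((Real.log t) ^ β * ℓ (Real.log t)))
        atTop (𝓝 (Real.log c)))
    (j : ℕ) (hj : 2 ≤ j) :
    -- membership in the class `Π`, with the constant inside the auxiliary function
    NestedKarlin.InDeHaanClassPi (NestedKarlin.rhoGen p j)
      (fun t : ℝ => (Real.Gamma (β + 1)) ^ j / Real.Gamma ((j : ℝ) * (β + 1)) *
        ((Real.log t) ^ ((j : ℝ) * β + (j : ℝ) - 1) * (ℓ (Real.log t)) ^ j)) ∧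
    (∀ c : ℝ, 0 < c →
      Tendsto (fun t : ℝ => (NestedKarlin.rhoGen p j (c * t) - NestedKarlin.rhoGen p j t) /
          ((Real.log t) ^ ((j : ℝ) * β + (j : ℝ) - 1) * (ℓ (Real.log t)) ^ j))
        atTop
        (𝓝 ((Real.Gamma (β + 1)) ^ j / Real.Gamma ((j : ℝ) * (β + 1)) * Real.log c))) ∧
    Tendsto (fun t : ℝ => NestedKarlin.rhoGen p j t /
        ((Real.log t) ^ ((j : ℝ) * (β + 1)) * (ℓ (Real.log t)) ^ j))
      atTop
      (𝓝 ((Real.Gamma (β + 1)) ^ j / Real.Gamma (1 + (j : ℝ) * (β + 1)))) := by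
  obtain ⟨n, rfl⟩ : ∃ n, j = n + 1 := ⟨j - 1, by omega⟩
  set g : ℝ → ℝ := fun y => y ^ β * ℓ y with hg_def
  have hg : IsRegGrowth g β := hℓ.isRegGrowth hβ hβ_zero
  have h1 : HasIncrements (levelCount (logWeight p (j := 1))) g 1 := by
    intro h
    have := (hρ (Real.exp h) (Real.exp_pos h)).comp Real.tendsto_exp_atTop
    rw [Real.log_exp, ← rhoGen_one] at this
    rw [one_mul]
    refine this.congr fun y => ?_
    simp only [Function.comp, Real.log_exp, ← Real.exp_add, rhoGen_exp hp_nonneg, hg_def,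
      add_comm h]
  have hinc := hasIncrements_logWeight hp_nonneg hp_sum hβ hg h1 n
  have hA := isRegGrowth_pow hg n
  set A : ℝ → ℝ := fun y => y ^ n * g y ^ (n + 1) with hA_def
  have hcast : (((n + 1 : ℕ) : ℝ)) = (n : ℝ) + 1 := by push_cast; rfl
  rw [hcast]
  set Γ₁ := Real.Gamma (((n : ℝ) + 1) * (β + 1)) with hΓ₁
  have hs : 0 < ((n : ℝ) + 1) * (β + 1) := by positivity
  have hC : 0 < Real.Gamma (β + 1) ^ (n + 1) / Γ₁ :=
    div_pos (pow_pos (Real.Gamma_pos_of_pos (by linarith)) _) (Real.Gamma_pos_of_pos hs)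
  set C := Real.Gamma (β + 1) ^ (n + 1) / Γ₁ with hC_def
  have hAeq : ∀ y, 0 < y →
      y ^ (((n : ℝ) + 1) * β + ((n : ℝ) + 1) - 1) * ℓ y ^ (n + 1) = A y := by
    intro y hy
    have e : ((n : ℝ) + 1) * β + ((n : ℝ) + 1) - 1 = (n : ℝ) + β * ((n + 1 : ℕ) : ℝ) := by
      push_cast; ring
    rw [e, Real.rpow_add hy, Real.rpow_natCast, Real.rpow_mul_natCast hy.le]
    simp only [hA_def, hg_def]
    ring
  have hlogpos : ∀ᶠ t : ℝ in atTop, 0 < t ∧ 0 < Real.log t :=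
    (eventually_gt_atTop 0).and (Real.tendsto_log_atTop.eventually_gt_atTop 0)
  have hstmt2 : ∀ c : ℝ, 0 < c →
      Tendsto (fun t : ℝ => (rhoGen p (n + 1) (c * t) - rhoGen p (n + 1) t) /
          ((Real.log t) ^ (((n : ℝ) + 1) * β + ((n : ℝ) + 1) - 1) * (ℓ (Real.log t)) ^ (n + 1)))
        atTop (𝓝 (C * Real.log c)) := by
    intro c hc
    refine ((hinc (Real.log c)).comp Real.tendsto_log_atTop).congr' ?_
    filter_upwards [hlogpos] with t ht
    simp only [Function.comp]
    rw [hAeq _ ht.2, ← rhoGen_exp hp_nonneg, ← rhoGen_exp hp_nonneg, Real.exp_add,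
      Real.exp_log ht.1, Real.exp_log hc, mul_comm t c]
  refine ⟨⟨⟨hℓ.exists_pos_measurable_comp_log _ _ _ hC, fun c hc => ?_⟩, fun c hc => ?_⟩, hstmt2, ?_⟩
  -- Slow variation in `t` is invariance of `A` under the bounded shift `log c` of `log t`.
  · have hsh := hA.tendsto_shift (f := fun t : ℝ => Real.log t + Real.log c)
      Real.tendsto_log_atTop |Real.log c| (Eventually.of_forall fun t => by simp)
    refine hsh.congr' ?_
    have hT : Tendsto (fun t : ℝ => Real.log t + Real.log c) atTop atTop :=
      tendsto_atTop_add_const_right _ _ Real.tendsto_log_atTop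
    filter_upwards [hlogpos, hT.eventually_gt_atTop 0] with t ht ht2
    rw [Real.log_mul hc.ne' ht.1.ne', add_comm (Real.log c), hAeq _ ht.2, hAeq _ ht2,
      mul_div_mul_left _ _ hC.ne']
  · have h := (hstmt2 c hc).div_const C
    rw [mul_div_cancel_left₀ _ hC.ne'] at h
    refine h.congr fun t => ?_
    rw [div_div, mul_comm _ C]
  · have hP := isProper_logWeight hp_nonneg hp_sum (n + 1)
    have hα : 0 ≤ ((n : ℝ) + 1) * (β + 1) - 1 := by
      have := Nat.cast_nonneg (α := ℝ) n
      nlinarith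
    -- Here `α + 1 = (n + 1)(β + 1)`, so the numerator `Γ(α + 1)` cancels the denominator of `C`.
    have h := (hinc.tendsto_total hA hα hP.levelCount_mono
      fun y hy => hP.levelCount_of_neg hy).comp Real.tendsto_log_atTop
    have e : C * (Real.Gamma (((n : ℝ) + 1) * (β + 1) - 1 + 1) /
        Real.Gamma (((n : ℝ) + 1) * (β + 1) - 1 + 1 + 1)) =
        Real.Gamma (β + 1) ^ (n + 1) / Real.Gamma (1 + ((n : ℝ) + 1) * (β + 1)) := by
      rw [sub_add_cancel, add_comm (1 : ℝ) (((n : ℝ) + 1) * (β + 1)), hC_def, ← hΓ₁,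
        div_mul_div_cancel₀ (Real.Gamma_pos_of_pos hs).ne']
    rw [e] at h
    refine h.congr' ?_
    filter_upwards [hlogpos] with t ht
    simp only [Function.comp]
    have e2 : ((n : ℝ) + 1) * (β + 1) = 1 + (((n : ℝ) + 1) * β + ((n : ℝ) + 1) - 1) := by ring
    rw [e2, Real.rpow_add ht.2, Real.rpow_one, mul_assoc, hAeq _ ht.2,
      ← rhoGen_exp hp_nonneg, Real.exp_log ht.1]
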